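/- Let $X$ be a real Banach space with closed unit ball $\mathbb{B}_X$. For a closed convex set $C\subseteq X$ and $x\in C$, a hyperplane supporting $C$ at $x$ is a set $\{y\in X:\varphi(y)=\varphi(x)\}$ with $\varphi\in X^*\setminus\{0\}$ and $\varphi(x)=\sup_{z\in C}\varphi(z)$; the point $x$ is called an almost exposed point of $C$ if it is the only point of $C$ that lies on all hyperplanes supporting $C$ at $x$. A map $F\colon\mathbb{B}_X\to\mathbb{B}_X$ is called nonexpansive if $\|F(x)-F(y)\|\le\|x-y\|$ for all $x,y\in\mathbb{B}_X$. Suppose that $X$ satisfies at least one of the following conditions: (i) $\mathbb{B}_X$ is the closed convex hull of its almost exposed points; (ii) $X$ is isometrically isomorphic to the space $C(K)$ of continuous real-valued functions, with the supremum norm, on some compact Hausdorff space $K$; (iii) $X$ is isometrically isomorphic to the space $c_0$ of real null sequences with the supremum norm. Then every surjective isometry $f\colon\mathbb{B}_X\to\mathbb{B}_X$ (not assumed linear) is an extreme point of the convex set $\mathcal{M}$ of all nonexpansive maps $\mathbb{B}_X\to\mathbb{B}_X$; that is, if $f=(1-\lambda)g+\lambda h$ with $\lambda\in(0,1)$ and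 $g,h\in\mathcal{M}$, then $g=h=f$. -/

import Mathlib

open scoped ZeroAtInfty

/-- `H` is a (closed, real) hyperplane supporting the set `C` at its point `x`: `H` is the level set
through `x` of a nonzero continuous real functional whose maximum over `C` is attained at `x`. -/
def IsSupportingHyperplaneAt {X : Type*} [NormedAddCommGroup X] [NormedSpace ℝ X]
    (C : Set X) (x : X) (H : Set X) : Prop :=
  x ∈ C ∧ ∃ φ : StrongDual ℝ X, φ ≠ 0 ∧ (∀ z ∈ C, φ z ≤ φ x) ∧ H = {y | φ y = φ x}

/-- The almost exposed points of `C`: those `x ∈ C` which are the only point of `C` lying on every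
hyperplane that supports `C` at `x`. -/
def almostExposedPoints {X : Type*} [NormedAddCommGroup X] [NormedSpace ℝ X]
    (C : Set X) : Set X :=
  {x | x ∈ C ∧ C ∩ ⋂₀ {H | IsSupportingHyperplaneAt C x H} = {x}}

/-- The nonexpansive self-maps of `C`, as a subset of the vector space of all maps `C → X`. -/
def nonexpansiveSelfMaps {X : Type*} [NormedAddCommGroup X] [NormedSpace ℝ X]
    (C : Set X) : Set (C → X) :=
  {F | (∀ x, F x ∈ C) ∧ ∀ x y, ‖F x - F y‖ ≤ ‖(x : X) - (y : X)‖}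

/-! Pull a decomposition of `f` back by `f⁻¹`. As `f⁻¹` is affine, this gives `id = a p + b q` with
`p`, `q` nonexpansive, and for `u = a (p - id)` both `id + u` and `id - u` are nonexpansive
self-maps of the ball. It remains to show `u = 0`. Affinity is a Mazur–Ulam argument with
reflections: suitable midpoints are centres of symmetry of metrically defined sets, so isometries
preserve them (`IsometryEquiv.closedBall_apply_midpoint`); homogeneity and continuity do the rest.
Under the convex hull hypothesis, `u` is constant along almost exposed directions, hence constant,
hence zero. In `C(K)` and `c₀`, each evaluation `φ` kills `u x`: compare `x` with a `y` of the ball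
where `φ y = 1` and `‖y - x‖ ≤ 1 - φ x` (`apply_eq_zero_of_functional`). -/

open Metric Filter Topology

/-! ### Centres of reflections in bounded metric spaces. -/

section Centre

/-- A point `z` that is the centre of a reflection of a bounded metric space is fixed by all
isometries of the space onto itself. -/
theorem IsometryEquiv.apply_centre_eq {α : Type*} [MetricSpace α] [BoundedSpace α]
    (R : α ≃ᵢ α) (z : α) (hR : ∀ x, dist (R x) x = 2 * dist x z) (e : α ≃ᵢ α) : e z = z := by
  have hbdd : BddAbove (Set.range fun e : α ≃ᵢ α => dist (e z) z) := by
    refine ⟨diam (Set.univ : Set α), ?_⟩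
    rintro _ ⟨e, rfl⟩
    exact dist_le_diam_of_mem (BoundedSpace.bounded_univ) trivial trivial
  -- The conjugate `e⁻¹ R e` moves `z` twice as far as `e` does, so the finite supremum of
  -- displacements is at most half of itself.
  have hdouble : ∀ e : α ≃ᵢ α, 2 * dist (e z) z ≤ ⨆ e : α ≃ᵢ α, dist (e z) z := by
    intro e
    have h := le_ciSup hbdd ((e.trans R).trans e.symm)
    have h2 : dist (((e.trans R).trans e.symm) z) z = 2 * dist (e z) z := by
      rw [← hR, ← e.dist_eq]
      simp
    exact h2 ▸ h
  have hle : (⨆ e : α ≃ᵢ α, dist (e z) z) ≤ (⨆ e : α ≃ᵢ α, dist (e z) z) / 2 :=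
    ciSup_le fun e => by linarith [hdouble e]
  have h0 := hdouble e
  exact dist_le_zero.1 (by linarith)

/-- Isometries between bounded metric spaces preserve centres of reflections. -/
theorem IsometryEquiv.apply_centre_eq_centre {α β : Type*} [MetricSpace α] [BoundedSpace α]
    [MetricSpace β] (R : α ≃ᵢ α) (z : α) (hR : ∀ x, dist (R x) x = 2 * dist x z)
    (R' : β ≃ᵢ β) (z' : β) (hR' : ∀ x, dist (R' x) x = 2 * dist x z') (e : α ≃ᵢ β) :
    e z = z' := by
  have h := R.apply_centre_eq z hR ((e.trans R').trans e.symm)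
  have h1 : R' (e z) = e z := by
    have := congrArg e h
    simpa using this
  have h2 := hR' (e z)
  rw [h1, dist_self] at h2
  exact dist_le_zero.1 (by linarith)

/-- The reflection of a subtype of a normed space that is symmetric about `z`. -/
theorem exists_reflection_of_symmetric {X : Type*} [NormedAddCommGroup X] [NormedSpace ℝ X]
    (C : Set X) (P : C → Prop) (z : C)
    (hC : ∀ x : C, P x → ∃ y : C, P y ∧ (y : X) = z + z - x) :
    ∃ R : {x // P x} ≃ᵢ {x // P x}, ∀ x, dist (R x) x = 2 * dist (x : C) z := by
  choose! ρ hρP hρ using hC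
  let r : {x // P x} → {x // P x} := fun x => ⟨ρ x, hρP x x.2⟩
  have hr : ∀ x, ((r x : C) : X) = z + z - (x : C) := fun x => hρ x x.2
  have hinv : Function.Involutive r := by
    intro x
    apply Subtype.ext
    apply Subtype.ext
    rw [hr, hr]
    abel
  refine ⟨⟨hinv.toPerm, Isometry.of_dist_eq fun x y => ?_⟩, fun x => ?_⟩
  · change dist (((r x : C) : X)) ((r y : C) : X) = dist ((x : C) : X) ((y : C) : X)
    rw [hr, hr, dist_sub_left]
  · change dist (((r x : C) : X)) ((x : C) : X) = 2 * dist ((x : C) : X) (z : X)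
    rw [hr, dist_eq_norm, dist_eq_norm,
      show (z : X) + z - (x : C) - (x : C) = (-2 : ℝ) • (((x : C) : X) - z) by module, norm_smul]
    norm_num

instance boundedSpace_subtype_closedBall {α : Type*} [PseudoMetricSpace α] (x : α) (r : ℝ)
    (P : closedBall x r → Prop) : BoundedSpace {y // P y} :=
  have : BoundedSpace (closedBall x r) := boundedSpace_subtype_iff.2 isBounded_closedBall
  boundedSpace_subtype_iff.2 (BoundedSpace.bounded_univ.subset (Set.subset_univ _))

end Centre

/-! ### Surjective isometries of the unit ball are affine. -/

section UnitBall

variable {X : Type*} [NormedAddCommGroup X] [NormedSpace ℝ X]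

theorem IsometryEquiv.closedBall_apply_zero
    (e : closedBall (0 : X) 1 ≃ᵢ closedBall (0 : X) 1) :
    ((e ⟨0, by simp⟩ : closedBall (0 : X) 1) : X) = 0 := by
  obtain ⟨R, hR⟩ := exists_reflection_of_symmetric (closedBall (0 : X) 1) (fun _ => True)
    ⟨0, by simp⟩ (fun x _ =>
      ⟨⟨-x, by simpa only [mem_closedBall, dist_zero_right, norm_neg] using x.2⟩, trivial, by simp⟩)
  have h := IsometryEquiv.apply_centre_eq_centre R ⟨⟨0, by simp⟩, trivial⟩ hR R
    ⟨⟨0, by simp⟩, trivial⟩ hR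
    ⟨e.toEquiv.subtypeEquiv (fun _ => Iff.rfl), Isometry.of_dist_eq fun x y => e.dist_eq x y⟩
  exact congrArg (fun x : {x : closedBall (0 : X) 1 // True} => ((x : closedBall (0 : X) 1) : X)) h

theorem IsometryEquiv.closedBall_norm_apply
    (e : closedBall (0 : X) 1 ≃ᵢ closedBall (0 : X) 1) (x : closedBall (0 : X) 1) :
    ‖(e x : X)‖ = ‖(x : X)‖ := by
  have h : dist (e x : X) (e ⟨0, by simp⟩ : closedBall (0 : X) 1) = dist (x : X) 0 :=
    e.dist_eq x ⟨0, by simp⟩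
  rwa [e.closedBall_apply_zero, dist_zero_right, dist_zero_right] at h

/-- The set is defined by distances to `x` and `y` alone, so isometries carry it along. `hr` keeps
the reflected points, which lie within `dist x y / 2` of `x`, inside the unit ball. -/
theorem exists_reflection_of_midpoint (x y z : closedBall (0 : X) 1)
    (hz : (z : X) = (1 / 2 : ℝ) • ((x : X) + y)) (hr : ‖(x : X)‖ + dist x y / 2 ≤ 1) :
    ∃ R : {w // dist w x ≤ dist x y / 2 ∧ dist w y ≤ dist x y / 2} ≃ᵢ
        {w // dist w x ≤ dist x y / 2 ∧ dist w y ≤ dist x y / 2},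
      ∀ w, dist (R w) w = 2 * dist (w : closedBall (0 : X) 1) z := by
  refine exists_reflection_of_symmetric _ _ z fun w hw => ?_
  have hzz : (z : X) + z = x + y := by rw [hz]; module
  have hx : dist ((z : X) + z - w) x ≤ dist x y / 2 := by
    rw [hzz, dist_eq_norm, show (x : X) + y - w - x = y - w by abel, ← dist_eq_norm, dist_comm]
    exact hw.2
  have hy : dist ((z : X) + z - w) y ≤ dist x y / 2 := by
    rw [hzz, dist_eq_norm, show (x : X) + y - w - y = x - w by abel, ← dist_eq_norm, dist_comm]
    exact hw.1
  refine ⟨⟨(z : X) + z - w, ?_⟩, ⟨hx, hy⟩, rfl⟩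
  rw [mem_closedBall, dist_zero_right]
  have := norm_le_norm_add_norm_sub' ((z : X) + z - w) x
  rw [dist_eq_norm] at hx
  linarith

theorem IsometryEquiv.closedBall_apply_midpoint
    (e : closedBall (0 : X) 1 ≃ᵢ closedBall (0 : X) 1) (x y z : closedBall (0 : X) 1)
    (hz : (z : X) = (1 / 2 : ℝ) • ((x : X) + y)) (hr : ‖(x : X)‖ + dist x y / 2 ≤ 1) :
    (e z : X) = (1 / 2 : ℝ) • ((e x : X) + e y) := by
  have hmid : ∀ x y z : closedBall (0 : X) 1, (z : X) = (1 / 2 : ℝ) • ((x : X) + y) →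
      dist z x ≤ dist x y / 2 ∧ dist z y ≤ dist x y / 2 := by
    intro x y z hz
    have h1 : dist z x = dist x y / 2 := by
      rw [Subtype.dist_eq, Subtype.dist_eq, hz, dist_eq_norm, dist_eq_norm,
        show (1 / 2 : ℝ) • ((x : X) + y) - x = (-(1 / 2) : ℝ) • ((x : X) - y) by module, norm_smul]
      norm_num
      ring
    have h2 : dist z y = dist x y / 2 := by
      rw [Subtype.dist_eq, Subtype.dist_eq, hz, dist_eq_norm, dist_eq_norm,
        show (1 / 2 : ℝ) • ((x : X) + y) - y = (1 / 2 : ℝ) • ((x : X) - y) by module, norm_smul]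
      norm_num
      ring
    exact ⟨h1.le, h2.le⟩
  have hmem : (1 / 2 : ℝ) • ((e x : X) + e y) ∈ closedBall (0 : X) 1 := by
    have h := (convex_closedBall (0 : X) 1) (e x).2 (e y).2 (by norm_num : (0 : ℝ) ≤ 1 / 2)
      (by norm_num : (0 : ℝ) ≤ 1 / 2) (by norm_num)
    rwa [← smul_add] at h
  obtain ⟨R, hR⟩ := exists_reflection_of_midpoint x y z hz hr
  obtain ⟨R', hR'⟩ := exists_reflection_of_midpoint (e x) (e y) ⟨_, hmem⟩ rfl
    (by rwa [e.closedBall_norm_apply, e.dist_eq])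
  have h := IsometryEquiv.apply_centre_eq_centre R ⟨z, hmid x y z hz⟩ hR R'
    ⟨⟨_, hmem⟩, hmid _ _ _ rfl⟩ hR'
    ⟨e.toEquiv.subtypeEquiv (fun w => by
        change _ ↔ dist (e w) (e x) ≤ dist (e x) (e y) / 2 ∧ dist (e w) (e y) ≤ _
        simp only [e.dist_eq]), Isometry.of_dist_eq fun x y => e.dist_eq x y⟩
  exact congrArg (fun w : {w // dist w (e x) ≤ dist (e x) (e y) / 2 ∧
    dist w (e y) ≤ dist (e x) (e y) / 2} => ((w : closedBall (0 : X) 1) : X)) h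

/-- The midpoint rule makes the values at multiples of `x / n` an arithmetic progression; points two
steps apart have half-distance `‖x‖ / n`, whence the condition on `n`. -/
theorem apply_natCast_div_smul_of_local_midpoint {F : X → X} (h0 : F 0 = 0)
    (hmid : ∀ x y : X, ‖x‖ ≤ 1 → ‖y‖ ≤ 1 → ‖x‖ + ‖x - y‖ / 2 ≤ 1 →
      F ((1 / 2 : ℝ) • (x + y)) = (1 / 2 : ℝ) • (F x + F y))
    {x : X} {n : ℕ} (hn : 0 < n) (hx : ‖x‖ + ‖x‖ / n ≤ 1) {k : ℕ} (hk : k ≤ n) :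
    F (((k : ℝ) / n) • x) = ((k : ℝ) / n) • F x := by
  have hn' : (0 : ℝ) < n := by exact_mod_cast hn
  have hx1 : ‖x‖ ≤ 1 := by
    have : 0 ≤ ‖x‖ / n := by positivity
    linarith
  have hnorm : ∀ k : ℕ, k ≤ n → ‖((k : ℝ) / n) • x‖ ≤ ‖x‖ := by
    intro k hk
    rw [norm_smul, Real.norm_of_nonneg (by positivity)]
    have hk' : (k : ℝ) ≤ n := by exact_mod_cast hk
    exact mul_le_of_le_one_left (norm_nonneg x) ((div_le_one hn').2 hk')
  -- The recurrence has order two, so the induction carries two consecutive values.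
  have step : ∀ k : ℕ, k + 1 ≤ n →
      F (((k : ℝ) / n) • x) = (k : ℝ) • F ((1 / n : ℝ) • x) ∧
      F ((((k + 1 : ℕ) : ℝ) / n) • x) = ((k + 1 : ℕ) : ℝ) • F ((1 / n : ℝ) • x) := by
    intro k
    induction k with
    | zero => intro _; simp [h0]
    | succ k ih =>
      intro hk
      obtain ⟨h1, h2⟩ := ih (by omega)
      refine ⟨h2, ?_⟩
      have hd : ((k : ℝ) / n) • x - (((k + 1 + 1 : ℕ) : ℝ) / n) • x = (-2 / n : ℝ) • x := by
        rw [← sub_smul]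
        congr 1
        push_cast
        ring
      have hd2 : ‖((k : ℝ) / n) • x - (((k + 1 + 1 : ℕ) : ℝ) / n) • x‖ / 2 = ‖x‖ / n := by
        rw [hd, norm_smul, norm_div, norm_neg, Real.norm_of_nonneg hn'.le]
        norm_num
        ring
      have h := hmid (((k : ℝ) / n) • x) ((((k + 1 + 1 : ℕ) : ℝ) / n) • x)
        ((hnorm k (by omega)).trans hx1) ((hnorm _ hk).trans hx1)
        (by rw [hd2]; linarith [hnorm k (by omega)])
      rw [← add_smul, smul_smul, show (1 / 2 : ℝ) * ((k : ℝ) / n + ((k + 1 + 1 : ℕ) : ℝ) / n)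
        = ((k + 1 : ℕ) : ℝ) / n by push_cast; field_simp; ring, h2, h1] at h
      have h' := congrArg (fun v => (2 : ℝ) • v - (k : ℝ) • F ((1 / n : ℝ) • x)) h
      calc F ((((k + 1 + 1 : ℕ) : ℝ) / n) • x)
          = (2 : ℝ) • (1 / 2 : ℝ) • ((k : ℝ) • F ((1 / n : ℝ) • x) +
              F ((((k + 1 + 1 : ℕ) : ℝ) / n) • x)) - (k : ℝ) • F ((1 / n : ℝ) • x) := by module
        _ = (2 : ℝ) • ((k + 1 : ℕ) : ℝ) • F ((1 / n : ℝ) • x) -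
              (k : ℝ) • F ((1 / n : ℝ) • x) := h'.symm
        _ = _ := by push_cast; module
  have hall : ∀ k : ℕ, k ≤ n → F (((k : ℝ) / n) • x) = (k : ℝ) • F ((1 / n : ℝ) • x) := by
    intro k hk
    cases k with
    | zero => simp [h0]
    | succ k => exact (step k hk).2
  have hxn : F x = (n : ℝ) • F ((1 / n : ℝ) • x) := by
    have := hall n le_rfl
    rwa [div_self hn'.ne', one_smul] at this
  rw [hall k hk, hxn, smul_smul, div_mul_cancel₀ _ hn'.ne']

theorem apply_smul_of_local_midpoint {F : X → X} (hF : ContinuousOn F (closedBall 0 1))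
    (h0 : F 0 = 0)
    (hmid : ∀ x y : X, ‖x‖ ≤ 1 → ‖y‖ ≤ 1 → ‖x‖ + ‖x - y‖ / 2 ≤ 1 →
      F ((1 / 2 : ℝ) • (x + y)) = (1 / 2 : ℝ) • (F x + F y))
    {x : X} (hx : ‖x‖ < 1) {t : ℝ} (ht0 : 0 ≤ t) (ht1 : t ≤ 1) : F (t • x) = t • F x := by
  have hlim : Tendsto (fun n : ℕ => (⌊t * n⌋₊ : ℝ) / n) atTop (𝓝 t) :=
    (tendsto_nat_floor_mul_div_atTop ht0).comp tendsto_natCast_atTop_atTop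
  have hfl : ∀ n : ℕ, ⌊t * n⌋₊ ≤ n := fun n =>
    Nat.floor_le_of_le (mul_le_of_le_one_left (Nat.cast_nonneg n) ht1)
  have hev : ∀ᶠ n : ℕ in atTop, 0 < n ∧ ‖x‖ + ‖x‖ / n ≤ 1 := by
    have h1 : Tendsto (fun n : ℕ => ‖x‖ + ‖x‖ / n) atTop (𝓝 (‖x‖ + 0)) :=
      tendsto_const_nhds.add (tendsto_const_div_atTop_nhds_zero_nat ‖x‖)
    rw [add_zero] at h1
    filter_upwards [eventually_gt_atTop 0, h1.eventually_le_const hx] with n h h'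
    exact ⟨h, h'⟩
  have hball : ∀ s : ℝ, 0 ≤ s → s ≤ 1 → s • x ∈ closedBall (0 : X) 1 := by
    intro s hs0 hs1
    rw [mem_closedBall, dist_zero_right, norm_smul, Real.norm_of_nonneg hs0]
    exact mul_le_one₀ hs1 (norm_nonneg x) hx.le
  have hl : Tendsto (fun n : ℕ => F (((⌊t * n⌋₊ : ℝ) / n) • x)) atTop (𝓝 (F (t • x))) := by
    refine (hF _ (hball t ht0 ht1)).tendsto.comp (tendsto_nhdsWithin_iff.2
      ⟨hlim.smul_const x, Eventually.of_forall fun n => hball _ (by positivity) ?_⟩)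
    exact div_le_one_of_le₀ (by exact_mod_cast hfl n) (Nat.cast_nonneg n)
  refine tendsto_nhds_unique (hl.congr' ?_) (hlim.smul_const (F x))
  filter_upwards [hev] with n hn
  exact apply_natCast_div_smul_of_local_midpoint h0 hmid hn.1 hn.2 (hfl n)

theorem apply_combo_of_local_midpoint {F : X → X} (hF : ContinuousOn F (closedBall 0 1))
    (h0 : F 0 = 0)
    (hmid : ∀ x y : X, ‖x‖ ≤ 1 → ‖y‖ ≤ 1 → ‖x‖ + ‖x - y‖ / 2 ≤ 1 →
      F ((1 / 2 : ℝ) • (x + y)) = (1 / 2 : ℝ) • (F x + F y))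
    {x y : X} (hx : ‖x‖ ≤ 1) (hy : ‖y‖ ≤ 1) {a b : ℝ} (ha : 0 ≤ a) (hb : 0 ≤ b)
    (hab : a + b = 1) : F (a • x + b • y) = a • F x + b • F y := by
  have hsmul : ∀ {x : X}, ‖x‖ < 1 → ∀ {t : ℝ}, 0 ≤ t → t ≤ 1 → F (t • x) = t • F x :=
    fun hx _ => apply_smul_of_local_midpoint hF h0 hmid hx
  have hcombo : ∀ {x y : X}, ‖x‖ < 1 → ‖y‖ < 1 → ∀ {a b : ℝ}, 0 ≤ a → 0 ≤ b → a + b = 1 →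
      F (a • x + b • y) = a • F x + b • F y := by
    intro x y hx hy a b ha hb hab
    have hw : ‖a • x + b • y‖ < 1 := by
      have := (convex_ball (0 : X) 1) (mem_ball_zero_iff.2 hx) (mem_ball_zero_iff.2 hy) ha hb hab
      exact mem_ball_zero_iff.1 this
    -- Shrinking by 4 gives room for the midpoint rule: norm plus half-distance is at most 1/2.
    -- Homogeneity then undoes the scaling.
    have hquarter : ∀ {x : X} {a : ℝ}, ‖x‖ < 1 → 0 ≤ a → a ≤ 1 → ‖(a / 4) • x‖ ≤ 1 / 4 := by
      intro x a hx ha ha1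
      rw [norm_smul, Real.norm_of_nonneg (by positivity)]
      nlinarith [norm_nonneg x]
    have hx4 := hquarter hx ha (by linarith)
    have hy4 := hquarter hy hb (by linarith)
    have h := hmid ((a / 4) • x) ((b / 4) • y) (by linarith) (by linarith)
      (by linarith [norm_sub_le ((a / 4) • x) ((b / 4) • y)])
    rw [show (1 / 2 : ℝ) • ((a / 4) • x + (b / 4) • y) = (1 / 8 : ℝ) • (a • x + b • y) by module,
      hsmul hw (by norm_num) (by norm_num), hsmul hx (by positivity) (by linarith),
      hsmul hy (by positivity) (by linarith),
      show (1 / 2 : ℝ) • ((a / 4) • F x + (b / 4) • F y) = (1 / 8 : ℝ) • (a • F x + b • F y)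
        by module] at h
    exact smul_right_injective X (by norm_num : (1 / 8 : ℝ) ≠ 0) h
  have hs : Tendsto (fun n : ℕ => (n : ℝ) / (n + 1)) atTop (𝓝 1) :=
    tendsto_natCast_div_add_atTop (1 : ℝ)
  have hs1 : ∀ n : ℕ, (n : ℝ) / (n + 1) < 1 := fun n => by
    rw [div_lt_one (by positivity)]; linarith
  have hball : ∀ {w : X}, ‖w‖ ≤ 1 → ∀ n : ℕ, ‖((n : ℝ) / (n + 1)) • w‖ < 1 := by
    intro w hw n
    rw [norm_smul, Real.norm_of_nonneg (by positivity)]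
    exact (mul_le_of_le_one_right (by positivity) hw).trans_lt (hs1 n)
  have hlim : ∀ {w : X}, ‖w‖ ≤ 1 →
      Tendsto (fun n : ℕ => F (((n : ℝ) / (n + 1)) • w)) atTop (𝓝 (F w)) := by
    intro w hw
    refine (hF w (mem_closedBall_zero_iff.2 hw)).tendsto.comp (tendsto_nhdsWithin_iff.2
      ⟨by simpa using hs.smul_const w, Eventually.of_forall fun n =>
        mem_closedBall_zero_iff.2 (hball hw n).le⟩)
  have hw : ‖a • x + b • y‖ ≤ 1 := by
    have := (convex_closedBall (0 : X) 1) (mem_closedBall_zero_iff.2 hx)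
      (mem_closedBall_zero_iff.2 hy) ha hb hab
    exact mem_closedBall_zero_iff.1 this
  refine tendsto_nhds_unique (hlim hw)
    ((((hlim hx).const_smul a).add ((hlim hy).const_smul b)).congr fun n => ?_)
  rw [← hcombo (hball hx n) (hball hy n) ha hb hab]
  congr 1
  module

/-- Isometries of the closed unit ball onto itself are affine. -/
theorem IsometryEquiv.closedBall_apply_combo
    (e : closedBall (0 : X) 1 ≃ᵢ closedBall (0 : X) 1) (x y w : closedBall (0 : X) 1)
    {a b : ℝ} (ha : 0 ≤ a) (hb : 0 ≤ b) (hab : a + b = 1) (hw : (w : X) = a • (x : X) + b • (y : X)) :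
    (e w : X) = a • (e x : X) + b • (e y : X) := by
  classical
  let F : X → X := fun x => if h : x ∈ closedBall (0 : X) 1 then (e ⟨x, h⟩ : X) else 0
  have hFe : ∀ x : closedBall (0 : X) 1, F x = e x := fun x => dif_pos x.2
  have hF : ContinuousOn F (closedBall 0 1) := by
    rw [continuousOn_iff_continuous_domRestrict]
    have : (closedBall (0 : X) 1).domRestrict F = fun x => (e x : X) := funext hFe
    rw [this]
    exact continuous_subtype_val.comp e.continuous
  have h0 : F 0 = 0 := (hFe ⟨0, by simp⟩).trans e.closedBall_apply_zero
  have hmid : ∀ x y : X, ‖x‖ ≤ 1 → ‖y‖ ≤ 1 → ‖x‖ + ‖x - y‖ / 2 ≤ 1 →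
      F ((1 / 2 : ℝ) • (x + y)) = (1 / 2 : ℝ) • (F x + F y) := by
    intro x y hx hy hr
    have hz : (1 / 2 : ℝ) • (x + y) ∈ closedBall (0 : X) 1 := by
      have h := (convex_closedBall (0 : X) 1) (mem_closedBall_zero_iff.2 hx)
        (mem_closedBall_zero_iff.2 hy) (by norm_num : (0 : ℝ) ≤ 1 / 2)
        (by norm_num : (0 : ℝ) ≤ 1 / 2) (by norm_num)
      rwa [← smul_add] at h
    have h := e.closedBall_apply_midpoint ⟨x, mem_closedBall_zero_iff.2 hx⟩
      ⟨y, mem_closedBall_zero_iff.2 hy⟩ ⟨_, hz⟩ rfl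
      (by rw [Subtype.dist_eq, dist_eq_norm]; exact hr)
    rwa [← hFe, ← hFe, ← hFe] at h
  have h := apply_combo_of_local_midpoint hF h0 hmid (mem_closedBall_zero_iff.1 x.2)
    (mem_closedBall_zero_iff.1 y.2) ha hb hab
  rwa [← hw, hFe, hFe, hFe] at h

end UnitBall

/-! ### Perturbations of the identity vanish. -/

section Perturbation

variable {X : Type*} [NormedAddCommGroup X] [NormedSpace ℝ X]

/-- `u` is a perturbation of the identity: both `id + u` and `id - u` are nonexpansive self-maps of
the closed unit ball. -/
structure IsNonexpansivePerturbation (u : X → X) : Prop where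
  norm_add_le : ∀ x, ‖x‖ ≤ 1 → ‖x + u x‖ ≤ 1
  norm_sub_le : ∀ x, ‖x‖ ≤ 1 → ‖x - u x‖ ≤ 1
  norm_sub_add_le : ∀ x y, ‖x‖ ≤ 1 → ‖y‖ ≤ 1 → ‖(x - y) + (u x - u y)‖ ≤ ‖x - y‖
  norm_sub_sub_le : ∀ x y, ‖x‖ ≤ 1 → ‖y‖ ≤ 1 → ‖(x - y) - (u x - u y)‖ ≤ ‖x - y‖

/-- A functional maximal over `C` at `e` must vanish on `v`, so `e + v` lies on every supporting
hyperplane at `e`. -/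
theorem eq_zero_of_mem_almostExposedPoints {C : Set X} {e v : X} (he : e ∈ almostExposedPoints C)
    (h1 : e + v ∈ C) (h2 : e - v ∈ C) : v = 0 := by
  have hmem : e + v ∈ C ∩ ⋂₀ {H | IsSupportingHyperplaneAt C e H} := by
    refine ⟨h1, ?_⟩
    rintro H ⟨-, φ, -, hφ, rfl⟩
    have h3 := hφ _ h1
    have h4 := hφ _ h2
    rw [map_add] at h3
    rw [map_sub] at h4
    change φ (e + v) = φ e
    rw [map_add]
    linarith
  rw [he.2] at hmem
  simpa using hmem

namespace IsNonexpansivePerturbation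

variable {u : X → X}

theorem continuousOn (hu : IsNonexpansivePerturbation u) : ContinuousOn u (closedBall 0 1) := by
  refine LipschitzOnWith.continuousOn (K := 1) (LipschitzOnWith.of_dist_le_mul fun x hx y hy => ?_)
  rw [mem_closedBall_zero_iff] at hx hy
  have h1 := hu.norm_sub_add_le x y hx hy
  have h2 := hu.norm_sub_sub_le x y hx hy
  have h3 : ‖(2 : ℝ) • (u x - u y)‖ ≤ ‖x - y‖ + ‖x - y‖ := by
    rw [show (2 : ℝ) • (u x - u y) = ((x - y) + (u x - u y)) - ((x - y) - (u x - u y)) by module]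
    exact (_root_.norm_sub_le _ _).trans (add_le_add h1 h2)
  rw [norm_smul, Real.norm_of_nonneg (by norm_num)] at h3
  rw [dist_eq_norm, dist_eq_norm, NNReal.coe_one]
  linarith

theorem apply_add_smul_of_mem_almostExposedPoints (hu : IsNonexpansivePerturbation u) {e : X}
    (he : e ∈ almostExposedPoints (closedBall (0 : X) 1)) {x : X} {t : ℝ} (hx : ‖x‖ ≤ 1)
    (hxt : ‖x + t • e‖ ≤ 1) : u (x + t • e) = u x := by
  rcases eq_or_ne t 0 with rfl | ht
  · simp
  have he1 : ‖e‖ ≤ 1 := mem_closedBall_zero_iff.1 he.1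
  have key : ∀ w : X, ‖t • e + w‖ ≤ ‖t • e‖ → ‖e + t⁻¹ • w‖ ≤ 1 := by
    intro w hw
    rw [show e + t⁻¹ • w = t⁻¹ • (t • e + w) by rw [smul_add, inv_smul_smul₀ ht], norm_smul]
    refine (mul_le_mul_of_nonneg_left hw (norm_nonneg _)).trans ?_
    rw [← norm_smul, inv_smul_smul₀ ht]
    exact he1
  have h1 := hu.norm_sub_add_le (x + t • e) x hxt hx
  have h2 := hu.norm_sub_sub_le (x + t • e) x hxt hx
  rw [add_sub_cancel_left] at h1 h2
  rw [sub_eq_add_neg] at h2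
  have h3 := key _ h1
  have h4 := key _ h2
  rw [smul_neg, ← sub_eq_add_neg] at h4
  have := eq_zero_of_mem_almostExposedPoints he (mem_closedBall_zero_iff.2 h3)
    (mem_closedBall_zero_iff.2 h4)
  exact sub_eq_zero.1 ((smul_eq_zero.1 this).resolve_left (inv_ne_zero ht))

/-- The directions along which `u` is constant on the open unit ball. -/
def constantDirections (u : X → X) : Submodule ℝ X where
  carrier := {v | ∀ (x : X) (t : ℝ), ‖x‖ < 1 → ‖x + t • v‖ < 1 → u (x + t • v) = u x}
  zero_mem' := by intro x t _ _; simp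
  smul_mem' := by
    intro c v hv x t hx hxt
    rw [smul_smul] at hxt ⊢
    exact hv x (t * c) hx hxt
  add_mem' := by
    intro v w hv hw x t hx hxt
    set d := t • (v + w) with hd
    -- The segment is cut into `n` pieces, each travelled along `v` and then `w`; `n` is large
    -- enough for the detours to stay in the open ball.
    obtain ⟨n, hn⟩ := exists_nat_gt (‖t • v‖ / (1 - max ‖x‖ ‖x + d‖))
    have hm : 0 < 1 - max ‖x‖ ‖x + d‖ := sub_pos.2 (max_lt hx hxt)
    have hn0 : (0 : ℝ) < n := lt_of_le_of_lt (by positivity) hn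
    have hseg : ∀ k : ℕ, k ≤ n → ‖x + ((k : ℝ) / n) • d‖ ≤ max ‖x‖ ‖x + d‖ := by
      intro k hk
      have hk1 : (k : ℝ) / n ≤ 1 := div_le_one_of_le₀ (by exact_mod_cast hk) hn0.le
      have := (convex_closedBall (0 : X) (max ‖x‖ ‖x + d‖))
        (mem_closedBall_zero_iff.2 (le_max_left _ _)) (mem_closedBall_zero_iff.2 (le_max_right _ _))
        (sub_nonneg.2 hk1) (by positivity : (0 : ℝ) ≤ (k : ℝ) / n) (by ring)
      rw [mem_closedBall_zero_iff] at this
      rwa [show (1 - (k : ℝ) / n) • x + ((k : ℝ) / n) • (x + d) = x + ((k : ℝ) / n) • d by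
        module] at this
    have hk : ∀ k : ℕ, k ≤ n → u (x + ((k : ℝ) / n) • d) = u x := by
      intro k
      induction k with
      | zero => intro _; simp
      | succ k ih =>
        intro hk
        have hlt : ∀ k : ℕ, k ≤ n → ‖x + ((k : ℝ) / n) • d‖ < 1 := fun k hk =>
          (hseg k hk).trans_lt (max_lt hx hxt)
        have hstep : x + (((k + 1 : ℕ) : ℝ) / n) • d =
            x + ((k : ℝ) / n) • d + (t / n) • v + (t / n) • w := by
          rw [hd]; push_cast; module
        have hv1 : ‖x + ((k : ℝ) / n) • d + (t / n) • v‖ < 1 := by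
          refine (_root_.norm_add_le _ _).trans_lt ?_
          have h1 : ‖(t / n) • v‖ = ‖t • v‖ / n := by
            rw [norm_smul, norm_smul, norm_div, Real.norm_of_nonneg hn0.le]; ring
          have h2 : ‖t • v‖ / n < 1 - max ‖x‖ ‖x + d‖ := by
            rw [div_lt_iff₀ hn0, mul_comm]
            exact (div_lt_iff₀ hm).1 hn
          rw [h1]
          linarith [hseg k (by omega)]
        have hw1 := hlt (k + 1) hk
        rw [hstep] at hw1 ⊢
        rw [hw _ _ hv1 hw1, hv _ _ (hlt k (by omega)) hv1, ih (by omega)]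
    have := hk n le_rfl
    rwa [div_self hn0.ne', one_smul] at this

theorem isClosed_constantDirections (hu : IsNonexpansivePerturbation u) :
    IsClosed (constantDirections u : Set X) := by
  refine isClosed_of_closure_subset fun v hv x t hx hxt => ?_
  obtain ⟨s, hs, hlim⟩ := mem_closure_iff_seq_limit.1 hv
  have h1 : Tendsto (fun n => x + t • s n) atTop (𝓝 (x + t • v)) :=
    tendsto_const_nhds.add (hlim.const_smul t)
  have h2 : ∀ᶠ n in atTop, ‖x + t • s n‖ < 1 := h1.norm.eventually_lt_const hxt
  have h3 : Tendsto (fun n => u (x + t • s n)) atTop (𝓝 (u (x + t • v))) :=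
    (hu.continuousOn _ (mem_closedBall_zero_iff.2 hxt.le)).tendsto.comp
      (tendsto_nhdsWithin_iff.2 ⟨h1, h2.mono fun n hn => mem_closedBall_zero_iff.2 hn.le⟩)
  refine tendsto_nhds_unique h3 (tendsto_const_nhds.congr' ?_)
  filter_upwards [h2] with n hn
  exact (hs n x t hx hn).symm

theorem eq_zero_of_closure_convexHull (hu : IsNonexpansivePerturbation u)
    (hX : closedBall (0 : X) 1 =
      closure (convexHull ℝ (almostExposedPoints (closedBall (0 : X) 1))))
    {x : X} (hx : ‖x‖ ≤ 1) : u x = 0 := by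
  have hball : closedBall (0 : X) 1 ⊆ constantDirections u := by
    rw [hX]
    refine closure_minimal (convexHull_min ?_ (Submodule.convex _)) hu.isClosed_constantDirections
    intro e he x t hx hxt
    exact hu.apply_add_smul_of_mem_almostExposedPoints he hx.le hxt.le
  have hopen : ∀ y ∈ ball (0 : X) 1, u y = u 0 := by
    intro y hy
    have h := hball (ball_subset_closedBall hy) 0 1 (by simp) (by simpa using hy)
    simpa using h
  have hconst : ∀ y, ‖y‖ ≤ 1 → u y = u 0 := by
    have h : Set.EqOn u (fun _ => u 0) (closedBall (0 : X) 1) :=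
      Set.EqOn.of_subset_closure hopen hu.continuousOn continuousOn_const ball_subset_closedBall
        (closure_ball (0 : X) one_ne_zero).ge
    exact fun y hy => h (mem_closedBall_zero_iff.2 hy)
  rw [hconst x hx]
  -- A nonzero constant value pushes its own unit vector out of the ball.
  by_contra hc
  have hc0 : 0 < ‖u 0‖ := norm_pos_iff.2 hc
  have hy : ‖‖u 0‖⁻¹ • u 0‖ ≤ 1 := by
    rw [norm_smul, norm_inv, norm_norm, inv_mul_cancel₀ hc0.ne']
  have h := hu.norm_add_le _ hy
  rw [hconst _ hy, show ‖u 0‖⁻¹ • u 0 + u 0 = (‖u 0‖⁻¹ + 1) • u 0 by module,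
    norm_smul, Real.norm_of_nonneg (by positivity), add_mul,
    inv_mul_cancel₀ hc0.ne'] at h
  linarith

/-- At `y` the bound `φ (y ± u y) ≤ 1` forces `φ (u y) = 0`. Since `φ (y - x)` already attains the
bound `‖y - x‖`, also `φ (u y - u x) = 0`. -/
theorem apply_eq_zero_of_functional (hu : IsNonexpansivePerturbation u) {φ : X →ₗ[ℝ] ℝ}
    (hφ : ∀ x, φ x ≤ ‖x‖) {x y : X} (hx : ‖x‖ ≤ 1) (hy : ‖y‖ ≤ 1) (hφy : φ y = 1)
    (hxy : ‖y - x‖ ≤ 1 - φ x) : φ (u x) = 0 := by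
  have h1 := (hφ _).trans (hu.norm_add_le y hy)
  have h2 := (hφ _).trans (hu.norm_sub_le y hy)
  have h3 := (hφ _).trans (hu.norm_sub_add_le y x hy hx)
  have h4 := (hφ _).trans (hu.norm_sub_sub_le y x hy hx)
  simp only [map_add, map_sub] at h1 h2 h3 h4
  linarith

theorem eq_zero_of_continuousMap (hu : IsNonexpansivePerturbation u) {K : Type*}
    [TopologicalSpace K] [CompactSpace K] (T : X ≃ₗᵢ[ℝ] C(K, ℝ)) {x : X} (hx : ‖x‖ ≤ 1) :
    u x = 0 := by
  rw [← T.map_eq_zero_iff]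
  ext s
  let φ : X →ₗ[ℝ] ℝ := (ContinuousMap.evalCLM ℝ s).toLinearMap ∘ₗ T.toLinearEquiv.toLinearMap
  have hφ : ∀ x, φ x = T x s := fun _ => rfl
  have hb : ∀ r, |T x r| ≤ 1 := fun r => ((T x).norm_coe_le_norm r).trans (by simpa using hx)
  -- Translating by `1 - T x s` makes the value at `s` equal to 1; truncation keeps `y` in the ball.
  let y : C(K, ℝ) := ⟨fun r => min 1 (T x r + (1 - T x s)), by fun_prop⟩
  have hy : ∀ r, y r = min 1 (T x r + (1 - T x s)) := fun _ => rfl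
  have hs := abs_le.1 (hb s)
  have h := hu.apply_eq_zero_of_functional (φ := φ) (x := x) (y := T.symm y)
    (fun z => (le_abs_self _).trans (((T z).norm_coe_le_norm s).trans_eq (T.norm_map z))) hx
    (by
      rw [T.symm.norm_map, ContinuousMap.norm_le _ zero_le_one]
      intro r
      have hr := abs_le.1 (hb r)
      rw [hy, Real.norm_eq_abs, abs_le]
      exact ⟨le_min (by norm_num) (by linarith), min_le_left _ _⟩)
    (by rw [hφ, T.apply_symm_apply, hy]; simp)
    (by
      rw [← T.norm_map, map_sub, T.apply_symm_apply, hφ,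
        ContinuousMap.norm_le _ (by linarith)]
      intro r
      have hr := abs_le.1 (hb r)
      rw [ContinuousMap.sub_apply, hy, Real.norm_eq_abs, abs_le]
      constructor
      · have : T x r ≤ min 1 (T x r + (1 - T x s)) := le_min hr.2 (by linarith)
        linarith
      · have := min_le_right 1 (T x r + (1 - T x s))
        linarith)
  exact h

theorem eq_zero_of_zeroAtInfty (hu : IsNonexpansivePerturbation u) (T : X ≃ₗᵢ[ℝ] C₀(ℕ, ℝ))
    {x : X} (hx : ‖x‖ ≤ 1) : u x = 0 := by
  rw [← T.map_eq_zero_iff]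
  ext s
  have hle : ∀ (z : C₀(ℕ, ℝ)) (r : ℕ), |z r| ≤ ‖z‖ := fun z r => by
    rw [← ZeroAtInftyContinuousMap.norm_toBCF_eq_norm]
    exact z.toBCF.norm_coe_le_norm r
  have hnorm : ∀ (z : C₀(ℕ, ℝ)) (c : ℝ), 0 ≤ c → (∀ r, |z r| ≤ c) → ‖z‖ ≤ c := fun z c hc h => by
    rw [← ZeroAtInftyContinuousMap.norm_toBCF_eq_norm]
    exact (BoundedContinuousFunction.norm_le hc).2 h
  let φ : X →ₗ[ℝ] ℝ :=
    { toFun := fun x => T x s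
      map_add' := fun x y => by simp
      map_smul' := fun c x => by simp }
  have hφ : ∀ x, φ x = T x s := fun _ => rfl
  have hb : ∀ r, |T x r| ≤ 1 := fun r => (hle _ r).trans (by simpa using hx)
  have hs := abs_le.1 (hb s)
  -- A translate would leave `c₀`, but points of `ℕ` are isolated, so only the coordinate `s` is
  -- changed.
  let y : C₀(ℕ, ℝ) :=
    { toFun := Function.update (T x) s 1
      continuous_toFun := continuous_of_discreteTopology
      zero_at_infty' := by
        refine (T x).zero_at_infty'.congr' ?_
        have : ∀ᶠ r in cocompact ℕ, r ≠ s := by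
          rw [cocompact_eq_cofinite]
          exact (Set.finite_singleton s).compl_mem_cofinite
        filter_upwards [this] with r hr
        exact (Function.update_of_ne hr _ _).symm }
  have hys : y s = 1 := Function.update_self _ _ _
  have hyr : ∀ r, r ≠ s → y r = T x r := fun r hr => Function.update_of_ne hr _ _
  have h := hu.apply_eq_zero_of_functional (φ := φ) (x := x) (y := T.symm y)
    (fun z => (le_abs_self _).trans ((hle (T z) s).trans_eq (T.norm_map z))) hx
    (by
      rw [T.symm.norm_map]
      refine hnorm _ _ zero_le_one fun r => ?_
      rcases eq_or_ne r s with rfl | hr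
      · rw [hys, abs_one]
      · rw [hyr r hr]
        exact hb r)
    (by rw [hφ, T.apply_symm_apply, hys])
    (by
      rw [← T.norm_map, map_sub, T.apply_symm_apply, hφ]
      refine hnorm _ _ (by linarith) fun r => ?_
      rw [ZeroAtInftyContinuousMap.sub_apply]
      rcases eq_or_ne r s with rfl | hr
      · rw [hys, abs_of_nonneg (by linarith)]
      · rw [hyr r hr, sub_self, abs_zero]
        linarith)
  exact h

end IsNonexpansivePerturbation

end Perturbation

/-! ### Reduction of extremality to perturbations of the identity. -/

theorem theorem1 {X : Type*} [NormedAddCommGroup X] [NormedSpace ℝ X] [CompleteSpace X]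
    (hX :
      Metric.closedBall (0 : X) 1 =
          closure (convexHull ℝ (almostExposedPoints (Metric.closedBall (0 : X) 1))) ∨
      (∃ (K : Type*) (_ : TopologicalSpace K) (_ : CompactSpace K) (_ : T2Space K),
          Nonempty (X ≃ₗᵢ[ℝ] C(K, ℝ))) ∨
      Nonempty (X ≃ₗᵢ[ℝ] C₀(ℕ, ℝ)))
    (f : Metric.closedBall (0 : X) 1 → Metric.closedBall (0 : X) 1)
    (hf : Isometry f) (hfs : Function.Surjective f) :
    (fun x => (f x : X)) ∈
      Set.extremePoints ℝ (nonexpansiveSelfMaps (Metric.closedBall (0 : X) 1)) := by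
  classical
  have hzero : ∀ u : X → X, IsNonexpansivePerturbation u → ∀ x, ‖x‖ ≤ 1 → u x = 0 := by
    intro u hu x hx
    rcases hX with h | ⟨K, _, _, _, ⟨T⟩⟩ | ⟨⟨T⟩⟩
    · exact hu.eq_zero_of_closure_convexHull h hx
    · exact hu.eq_zero_of_continuousMap T hx
    · exact hu.eq_zero_of_zeroAtInfty T hx
  refine ⟨⟨fun x => (f x).2, fun x y => ?_⟩, ?_⟩
  · rw [← dist_eq_norm, ← dist_eq_norm]
    exact (hf.dist_eq x y).le
  rintro g ⟨hg, hg'⟩ h ⟨hh, hh'⟩ ⟨a, b, ha, hb, hab, hfgh⟩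
  let e : closedBall (0 : X) 1 ≃ᵢ closedBall (0 : X) 1 :=
    ⟨Equiv.ofBijective f ⟨hf.injective, hfs⟩, hf⟩
  let p : closedBall (0 : X) 1 → closedBall (0 : X) 1 := fun x => e.symm ⟨g x, hg x⟩
  let q : closedBall (0 : X) 1 → closedBall (0 : X) 1 := fun x => e.symm ⟨h x, hh x⟩
  have hp : ∀ x y, ‖(p x : X) - p y‖ ≤ ‖(x : X) - y‖ := fun x y => by
    rw [← dist_eq_norm]
    exact (e.symm.dist_eq _ _).trans_le ((dist_eq_norm _ _).trans_le (hg' x y))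
  have hq : ∀ x y, ‖(q x : X) - q y‖ ≤ ‖(x : X) - y‖ := fun x y => by
    rw [← dist_eq_norm]
    exact (e.symm.dist_eq _ _).trans_le ((dist_eq_norm _ _).trans_le (hh' x y))
  have hpq : ∀ x : closedBall (0 : X) 1, (x : X) = a • (p x : X) + b • (q x : X) := by
    intro x
    have := e.symm.closedBall_apply_combo ⟨g x, hg x⟩ ⟨h x, hh x⟩ (f x) ha.le hb.le hab
      (congrFun hfgh x).symm
    rwa [show e.symm (f x) = x from e.symm_apply_apply x] at this
  have hcombo : ∀ {v w : X} {c : ℝ}, ‖v‖ ≤ c → ‖w‖ ≤ c → ∀ {s t : ℝ}, 0 ≤ s → 0 ≤ t → s + t = 1 →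
      ‖s • v + t • w‖ ≤ c := fun hv hw _ _ hs ht hst =>
    mem_closedBall_zero_iff.1 (convex_closedBall (0 : X) _ (mem_closedBall_zero_iff.2 hv)
      (mem_closedBall_zero_iff.2 hw) hs ht hst)
  -- The factor `a` makes `id + u = b id + a p` and `id - u = a id + b q`, both convex combinations
  -- of nonexpansive maps. The value 0 off the ball plays no role.
  let u : X → X := fun x => if hx : x ∈ closedBall (0 : X) 1 then a • ((p ⟨x, hx⟩ : X) - x) else 0
  have hup : ∀ x : closedBall (0 : X) 1, u x = a • ((p x : X) - x) := fun x => dif_pos x.2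
  have hadd : ∀ x : closedBall (0 : X) 1, (x : X) + u x = b • (x : X) + a • (p x : X) := by
    intro x
    rw [hup, show b = 1 - a by linarith]
    module
  have hsub : ∀ x : closedBall (0 : X) 1, (x : X) - u x = a • (x : X) + b • (q x : X) := by
    intro x
    rw [hup, smul_sub]
    nth_rewrite 1 [hpq x]
    abel
  have hu : IsNonexpansivePerturbation u := by
    refine ⟨fun x hx => ?_, fun x hx => ?_, fun x y hx hy => ?_, fun x y hx hy => ?_⟩
    · lift x to closedBall (0 : X) 1 using mem_closedBall_zero_iff.2 hx
      rw [hadd]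
      exact hcombo hx (mem_closedBall_zero_iff.1 (p x).2) hb.le ha.le (by linarith)
    · lift x to closedBall (0 : X) 1 using mem_closedBall_zero_iff.2 hx
      rw [hsub]
      exact hcombo hx (mem_closedBall_zero_iff.1 (q x).2) ha.le hb.le hab
    · lift x to closedBall (0 : X) 1 using mem_closedBall_zero_iff.2 hx
      lift y to closedBall (0 : X) 1 using mem_closedBall_zero_iff.2 hy
      rw [← add_sub_add_comm, hadd, hadd, add_sub_add_comm, ← smul_sub, ← smul_sub]
      exact hcombo le_rfl (hp x y) hb.le ha.le (by linarith)
    · lift x to closedBall (0 : X) 1 using mem_closedBall_zero_iff.2 hx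
      lift y to closedBall (0 : X) 1 using mem_closedBall_zero_iff.2 hy
      rw [sub_sub_sub_comm, hsub, hsub, add_sub_add_comm, ← smul_sub, ← smul_sub]
      exact hcombo le_rfl (hq x y) ha.le hb.le hab
  funext x
  have hux := hzero u hu x (mem_closedBall_zero_iff.1 x.2)
  rw [hup] at hux
  have hpx : p x = x :=
    Subtype.ext (sub_eq_zero.1 ((smul_eq_zero.1 hux).resolve_left ha.ne'))
  have : (⟨g x, hg x⟩ : closedBall (0 : X) 1) = f x := e.symm_apply_eq.1 hpx
  exact congrArg Subtype.val this
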